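/- **Setting.** Let $\mathcal X\subseteq\mathbb R^m$ be closed and convex, let $f:\mathcal X\to\mathbb R$ be convex and attain its minimum at $x_\star\in\mathcal X$, let $\partial f(x)=\{v:\ f(y)\ge f(x)+\langle v,y-x\rangle\ \text{for all } y\in\mathcal X\}$, and let $\|\cdot\|$ be the Euclidean norm. A stochastic gradient oracle $\mathcal G$ returns, when queried at $x\in\mathcal X$, a fresh random vector $\mathcal G(x)$ (its law depends measurably on $x$, and given the past only on the query point $x$) with $\nabla f(x):=\mathbb E[\mathcal G(x)]\in\partial f(x)$. Assume there is a continuous $\ell:\mathcal X\to\mathbb R$ such that for every $x\in\mathcal X$, $\|\mathcal G(x)\|\le\ell(x)$ almost surely. **T-DoG.** Let $T\in\mathbb N$, $\delta\in(0,1)$, $r_\epsilon>0$ and $x_0\in\mathcal X$. For $0\le t<T$ put $$x_{t+1}=\mathrm{Proj}_{\mathcal X}(x_t-\eta_t g_t),\qquad g_t=\mathcal G(x_t),\qquad \eta_t=\frac{\bar r_t}{\sqrt{G'_t}},$$ where $\mathrm{Proj}_{\mathcal X}$ is the Euclidean projection, $\bar r_t=\max\{\max_{k\le t}\|x_k-x_0\|,\,r_\epsilon\}$,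 $\bar\ell_t=\max_{k\le t}\ell(x_k)$, $G_{t-1}=\sum_{k<t}\|g_k\|^2$ (so $G_{-1}=0$), $\log_+z=1+\log z$, and $$G'_t=8^4\,\theta^2\,\log_+^2\!\Bigl(1+\frac{t\,\bar\ell_t^{\,2}}{\bar\ell_0^{\,2}}\Bigr)\bigl(G_{t-1}+16\,\bar\ell_t^{\,2}\bigr),\qquad \theta=\theta_{T,\delta}:=\log\Bigl(\frac{60\log(6T)}{\delta}\Bigr).$$ If $\ell(x_0)=0$ (so that $g_0=0$), a quotient with denominator $0$ is read as $0$; and for $T=0$ no step is taken. **Proposition.** Let $d_0=\|x_0-x_\star\|$ and suppose $r_\epsilon\le 3d_0$. Then $$\mathbb P\bigl(\bar r_T>3d_0\bigr)\le\delta .$$ Moreover, in the noiseless case, that is, when $g_t\in\partial f(x_t)$ and $\|g_t\|\le\ell(x_t)$ for all $t<T$ with $\ell$ continuous on $\mathcal X$, the bound $\bar r_T\le 3d_0$ holds deterministically, both for $\theta=\theta_{T,\delta}$ and with $\theta$ replaced by $1$. -/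

import Mathlib

open MeasureTheory ProbabilityTheory

noncomputable section

/-- `m`-dimensional Euclidean space. -/
abbrev Euc (m : ℕ) : Type := EuclideanSpace ℝ (Fin m)

/-- The subdifferential at `x` of a function `f` with domain `X`. -/
def subdifferential {m : ℕ} (X : Set (Euc m)) (f : Euc m → ℝ) (x : Euc m) : Set (Euc m) :=
  {v | ∀ y ∈ X, f x + inner ℝ v (y - x) ≤ f y}

/-- `p` is the Euclidean projection of `z` onto `X` (for closed convex nonempty `X` there is
exactly one such `p`). -/
def IsEuclideanProj {m : ℕ} (X : Set (Euc m)) (z p : Euc m) : Prop :=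
  p ∈ X ∧ ∀ y ∈ X, ‖z - p‖ ≤ ‖z - y‖

/-- `log₊ z = 1 + log z`. -/
def logPlus (z : ℝ) : ℝ := 1 + Real.log z

/-- `θ_{t,δ} = log (60 log (6 t) / δ)`. -/
def timeUniformLog (t : ℕ) (δ : ℝ) : ℝ :=
  Real.log (60 * Real.log (6 * (t : ℝ)) / δ)

/-- `r̄_t = max (max_{k ≤ t} ‖x_k - x_0‖) r_ε`. -/
def rBar {m : ℕ} (rε : ℝ) (x : ℕ → Euc m) (t : ℕ) : ℝ :=
  max ((Finset.range (t + 1)).sup' Finset.nonempty_range_add_one (fun k => ‖x k - x 0‖)) rε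

/-- `ℓ̄_t = max_{k ≤ t} ℓ (x_k)`. -/
def lBar {m : ℕ} (ℓ : Euc m → ℝ) (x : ℕ → Euc m) (t : ℕ) : ℝ :=
  (Finset.range (t + 1)).sup' Finset.nonempty_range_add_one (fun k => ℓ (x k))

/-- The sum `∑_{k < t} ‖g_k‖²`, that is `G_{t-1}`, with `G_{-1} = 0`. -/
def gradSqSumBefore {m : ℕ} (g : ℕ → Euc m) (t : ℕ) : ℝ :=
  ∑ k ∈ Finset.range t, ‖g k‖ ^ 2

/-- The T-DoG normalization
`G'_t = 8⁴ θ² log₊² (1 + t ℓ̄_t² / ℓ̄_0²) (G_{t-1} + 16 ℓ̄_t²)`,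
for a given value of the factor `θ`. -/
def tdogG {m : ℕ} (ℓ : Euc m → ℝ) (θ : ℝ) (x g : ℕ → Euc m) (t : ℕ) : ℝ :=
  8 ^ 4 * θ ^ 2 * logPlus (1 + t * lBar ℓ x t ^ 2 / lBar ℓ x 0 ^ 2) ^ 2 *
    (gradSqSumBefore g t + 16 * lBar ℓ x t ^ 2)

/-- The T-DoG step size `η_t = r̄_t / √G'_t`. -/
def tdogStep {m : ℕ} (ℓ : Euc m → ℝ) (rε θ : ℝ) (x g : ℕ → Euc m) (t : ℕ) : ℝ :=
  rBar rε x t / √(tdogG ℓ θ x g t)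

/-- `x_0, …, x_T` are the iterates of `T` steps of projected SGD over `X` with the T-DoG step
sizes, started at `x₀` and fed with the gradient estimates `g_0, …, g_{T-1}`. -/
structure IsTDoG {m : ℕ} (X : Set (Euc m)) (ℓ : Euc m → ℝ) (rε θ : ℝ) (x₀ : Euc m) (T : ℕ)
    (x g : ℕ → Euc m) : Prop where
  init : x 0 = x₀
  step : ∀ t < T, IsEuclideanProj X (x t - tdogStep ℓ rε θ x g t • g t) (x (t + 1))

/-- A stochastic gradient oracle for `f : X → ℝ`: `O x` is the law of the random vector returned
when the oracle is queried at `x`, and for `x ∈ X` its mean is a subgradient of `f` at `x`.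
(Values of `O` outside `X` play no role.) -/
structure IsStochasticGradientOracle {m : ℕ} (X : Set (Euc m)) (f : Euc m → ℝ)
    (O : Kernel (Euc m) (Euc m)) : Prop where
  markov : IsMarkovKernel O
  integrable : ∀ x ∈ X, Integrable (fun v => v) (O x)
  mean_mem : ∀ x ∈ X, ∫ v, v ∂(O x) ∈ subdifferential X f x

/-- Pointwise bounded stochastic gradients: `ℓ` is continuous on `X` and the response of the
oracle at `x ∈ X` has norm at most `ℓ x` almost surely. -/
structure IsPointwiseBound {m : ℕ} (X : Set (Euc m)) (O : Kernel (Euc m) (Euc m))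
    (ℓ : Euc m → ℝ) : Prop where
  continuousOn : ContinuousOn ℓ X
  bound : ∀ x ∈ X, ∀ᵐ v ∂(O x), ‖v‖ ≤ ℓ x

/-- The sigma-algebra `σ(g_0, …, g_{t-1})`. -/
abbrev gradHistory {m : ℕ} {Ω : Type*} (g : ℕ → Ω → Euc m) (t : ℕ) : MeasurableSpace Ω :=
  ⨆ k ∈ Finset.range t, MeasurableSpace.comap (g k) inferInstance

/-- The random vectors `g_0, …, g_{T-1}` are the responses of the oracle `O` to the successive
queries `x_0, …, x_{T-1}`: given the past responses, `g_t` has law `O (x_t)`. -/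
structure IsOracleResponse {m : ℕ} {Ω : Type*} [MeasurableSpace Ω] (μ : Measure Ω)
    (O : Kernel (Euc m) (Euc m)) (T : ℕ) (x g : ℕ → Ω → Euc m) : Prop where
  measurable : ∀ t < T, Measurable (g t)
  condLaw : ∀ t < T, ∀ B : Set (Euc m), MeasurableSet B →
    μ⟦g t ⁻¹' B | gradHistory g t⟧ =ᵐ[μ] fun ω => (O (x t ω)).real B

end

/-! ### Euclidean projections -/

/-! Write d for d₀. Nonexpansiveness of the projection gives ‖x_{t+1} - x_⋆‖² ≤ ‖x_t - x_⋆‖² -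
2η_t⟪g_t, x_t - x_⋆⟫ + η_t²‖g_t‖². Replacing η_t by 0 once r̄_t > 3d (`stoppedStep`) changes nothing
before the first exit from the ball of radius 3d, and makes the terms bounded along the whole
trajectory. The stopped second-order terms sum to at most d², because the logarithm in G'_t makes
them telescope (`sum_sq_div_logPlus_sq_le`). Hence if the stopped sum of -η_t⟪g_t, x_t - x_⋆⟫ is at
most d², the first exit point would satisfy ‖x_n - x_⋆‖² ≤ d² + 2d² + d², so ‖x_n - x_0‖ ≤ 3d, a
contradiction (`IsTDoG.rBar_le`). Without noise every term of that sum is nonpositive.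

With noise each term has nonpositive conditional mean, since E[g_t | past] is a subgradient; no
centering is needed. For u_t a suitable multiple of the term, |u_t| ≤ 3/8 and exp(u_t - u_t²) ≤ 1 +
u_t, so E exp(∑(u_t - u_t²)) ≤ 1 (`lintegral_exp_sum_le_one`). As ∑u_t² is bounded, a stopped sum
above d² makes this exponential at least 1/δ, and Markov's inequality concludes. The stopped sum is
frozen after the exit, so its value at time T suffices and no maximal inequality is used. -/

theorem IsEuclideanProj.inner_nonpos {m : ℕ} {X : Set (Euc m)} (hX : Convex ℝ X) {z p : Euc m}
    (h : IsEuclideanProj X z p) {y : Euc m} (hy : y ∈ X) : inner ℝ (z - p) (y - p) ≤ 0 := by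
  refine (norm_eq_iInf_iff_real_inner_le_zero hX h.1).1 ?_ y hy
  have : Nonempty X := ⟨⟨p, h.1⟩⟩
  refine le_antisymm (le_ciInf fun w => h.2 w w.2) ?_
  exact ciInf_le ⟨0, by rintro _ ⟨w, rfl⟩; exact norm_nonneg _⟩ (⟨p, h.1⟩ : X)

theorem IsEuclideanProj.norm_sub_le {m : ℕ} {X : Set (Euc m)} (hX : Convex ℝ X)
    {z z' p p' : Euc m} (h : IsEuclideanProj X z p) (h' : IsEuclideanProj X z' p') :
    ‖p - p'‖ ≤ ‖z - z'‖ := by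
  have h1 := h.inner_nonpos hX h'.1
  have h2 := h'.inner_nonpos hX h.1
  have h3 : ‖p - p'‖ * ‖p - p'‖ ≤ inner ℝ (z - z') (p - p') := by
    rw [← real_inner_self_eq_norm_mul_norm]
    have e1 : inner ℝ (z - p) (p' - p) = -inner ℝ (z - p) (p - p') := by
      rw [← inner_neg_right, neg_sub]
    have e2 : inner ℝ (p - p') (p - p') + inner ℝ (z - p) (p - p') - inner ℝ (z' - p') (p - p')
        = inner ℝ (z - z') (p - p') := by
      rw [← inner_add_left, ← inner_sub_left]
      congr 1
      abel
    linarith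
  have h4 := h3.trans (real_inner_le_norm _ _)
  by_contra! hlt
  nlinarith [norm_nonneg (p - p'), norm_nonneg (z - z')]

theorem isEuclideanProj_self {m : ℕ} {X : Set (Euc m)} {z : Euc m} (hz : z ∈ X) :
    IsEuclideanProj X z z := ⟨hz, fun y _ => by simp⟩

theorem IsEuclideanProj.unique {m : ℕ} {X : Set (Euc m)} (hX : Convex ℝ X) {z p p' : Euc m}
    (h : IsEuclideanProj X z p) (h' : IsEuclideanProj X z p') : p = p' := by
  have := h.norm_sub_le hX h'
  rw [sub_self, norm_zero] at this
  exact sub_eq_zero.1 (norm_le_zero_iff.1 this)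

theorem exists_isEuclideanProj {m : ℕ} {X : Set (Euc m)} (hc : IsClosed X) (hne : X.Nonempty)
    (hX : Convex ℝ X) (z : Euc m) : ∃ p, IsEuclideanProj X z p := by
  obtain ⟨p, hp, h⟩ := exists_norm_eq_iInf_of_complete_convex hne hc.isComplete hX z
  refine ⟨p, hp, fun y hy => h.trans_le ?_⟩
  exact ciInf_le ⟨0, by rintro _ ⟨w, rfl⟩; exact norm_nonneg _⟩ (⟨y, hy⟩ : X)

/-- The projection onto a nonempty closed convex set is a measurable map. -/
theorem exists_measurable_isEuclideanProj {m : ℕ} {X : Set (Euc m)} (hc : IsClosed X)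
    (hne : X.Nonempty) (hX : Convex ℝ X) :
    ∃ P : Euc m → Euc m, Measurable P ∧ ∀ z, IsEuclideanProj X z (P z) := by
  choose P hP using exists_isEuclideanProj hc hne hX
  have hL : LipschitzWith 1 P := LipschitzWith.of_dist_le_mul fun a b => by
    simpa [dist_eq_norm] using (hP a).norm_sub_le hX (hP b)
  exact ⟨P, hL.continuous.measurable, hP⟩

theorem IsEuclideanProj.sq_norm_sub_le {m : ℕ} {X : Set (Euc m)} (hX : Convex ℝ X)
    {x p g y : Euc m} {η : ℝ} (h : IsEuclideanProj X (x - η • g) p) (hy : y ∈ X) :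
    ‖p - y‖ ^ 2 ≤ ‖x - y‖ ^ 2 + 2 * -inner ℝ g (η • (x - y)) + η ^ 2 * ‖g‖ ^ 2 := by
  have h1 := h.norm_sub_le hX (isEuclideanProj_self hy)
  have h2 : ‖p - y‖ ^ 2 ≤ ‖(x - y) - η • g‖ ^ 2 := by
    rw [show (x - y) - η • g = x - η • g - y by abel]
    gcongr
  rw [norm_sub_sq_real (x - y) (η • g), inner_smul_right, norm_smul, mul_pow, Real.norm_eq_abs, sq_abs,
    real_inner_comm] at h2
  rw [inner_smul_right]
  linarith

/-! ### Running maxima -/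

theorem rBar_le_iff {m : ℕ} {rε R : ℝ} {x : ℕ → Euc m} {t : ℕ} :
    rBar rε x t ≤ R ↔ (∀ k ≤ t, ‖x k - x 0‖ ≤ R) ∧ rε ≤ R := by
  simp [rBar]

theorem rBar_mono {m : ℕ} (rε : ℝ) (x : ℕ → Euc m) : Monotone (rBar rε x) := by
  intro s t hst
  obtain ⟨h1, h2⟩ := rBar_le_iff.1 (le_refl (rBar rε x t))
  exact rBar_le_iff.2 ⟨fun k hk => h1 k (hk.trans hst), h2⟩

theorem lBar_mono {m : ℕ} (ℓ : Euc m → ℝ) (x : ℕ → Euc m) : Monotone (lBar ℓ x) := by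
  intro s t hst
  exact Finset.sup'_mono _ (Finset.range_mono (by omega)) _

theorem le_lBar {m : ℕ} (ℓ : Euc m → ℝ) (x : ℕ → Euc m) (t : ℕ) : ℓ (x t) ≤ lBar ℓ x t :=
  Finset.le_sup' (fun k => ℓ (x k)) (by simp)

theorem lBar_zero {m : ℕ} (ℓ : Euc m → ℝ) (x : ℕ → Euc m) : lBar ℓ x 0 = ℓ (x 0) := by
  simp [lBar]

/-! ### The logarithmic sum -/

theorem one_le_logPlus {z : ℝ} (hz : 1 ≤ z) : 1 ≤ logPlus z := by
  have := Real.log_nonneg hz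
  unfold logPlus
  linarith

/-- A discrete form of the fact that 1/(z log₊² z) is the derivative of -1/log₊ z. -/
theorem sub_div_mul_logPlus_sq_le {a b : ℝ} (ha : 1 ≤ a) (hab : a ≤ b) :
    (b - a) / (b * logPlus b ^ 2) ≤ 1 / logPlus a - 1 / logPlus b := by
  have hb : 0 < b := by linarith
  have ha0 : 0 < a := by linarith
  have h1 := one_le_logPlus ha
  have hlog : (b - a) / b ≤ logPlus b - logPlus a := by
    have h := Real.log_le_sub_one_of_pos (div_pos ha0 hb)
    rw [Real.log_div ha0.ne' hb.ne'] at h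
    have : (b - a) / b = 1 - a / b := by field_simp
    unfold logPlus
    linarith
  have h0 : 0 ≤ (b - a) / b := div_nonneg (by linarith) hb.le
  have h2 : logPlus a ≤ logPlus b := by linarith
  have hpa : 0 < logPlus a := by linarith
  have hpb : 0 < logPlus b := by linarith
  calc (b - a) / (b * logPlus b ^ 2) = (b - a) / b / (logPlus b ^ 2) := by rw [div_div]
    _ ≤ (logPlus b - logPlus a) / (logPlus b ^ 2) := by gcongr
    _ ≤ (logPlus b - logPlus a) / (logPlus a * logPlus b) := by
        apply div_le_div_of_nonneg_left (by linarith) (by positivity)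
        nlinarith
    _ = 1 / logPlus a - 1 / logPlus b := by field_simp

/-- With A_k = 1 + (∑_{j<k} b_j²)/L_0², each term is at most four times the telescoping difference
1/log₊ A_k - 1/log₊ A_{k+1}, and log₊ A_0 = 1. The factor 4 is the price of replacing A_{k+1} inside
the logarithm by a quantity that does not involve b_k. -/
theorem sum_sq_div_logPlus_sq_le {L b : ℕ → ℝ} (hL : Monotone L) (hL0 : 0 < L 0) {n : ℕ}
    (hb0 : ∀ k, 0 ≤ b k) (hb : ∀ k < n, b k ≤ L k) :
    ∑ k ∈ Finset.range n, b k ^ 2 / (logPlus (1 + k * L k ^ 2 / L 0 ^ 2) ^ 2 *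
      (∑ j ∈ Finset.range k, b j ^ 2 + 16 * L k ^ 2)) ≤ 4 := by
  set G : ℕ → ℝ := fun k => ∑ j ∈ Finset.range k, b j ^ 2 with hG
  have hG0 : ∀ k, 0 ≤ G k := fun k => Finset.sum_nonneg fun j _ => sq_nonneg _
  have hGs : ∀ k, G (k + 1) = G k + b k ^ 2 := fun k => Finset.sum_range_succ _ _
  have hone : ∀ k, 1 ≤ 1 + G k / L 0 ^ 2 := fun k => by
    have : 0 ≤ G k / L 0 ^ 2 := div_nonneg (hG0 k) (by positivity)
    linarith
  suffices h : ∑ k ∈ Finset.range n, b k ^ 2 / (logPlus (1 + k * L k ^ 2 / L 0 ^ 2) ^ 2 *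
      (G k + 16 * L k ^ 2)) ≤ 4 * (1 - 1 / logPlus (1 + G n / L 0 ^ 2)) by
    refine h.trans ?_
    have : 0 ≤ 1 / logPlus (1 + G n / L 0 ^ 2) :=
      div_nonneg zero_le_one (zero_le_one.trans (one_le_logPlus (hone n)))
    linarith
  induction n with
  | zero => simp [hG, logPlus]
  | succ n ih =>
    rw [Finset.sum_range_succ]
    have ih' := ih fun k hk => hb k (by omega)
    have hLn : L 0 ≤ L n := hL (Nat.zero_le n)
    have hLpos : 0 < L n := hL0.trans_le hLn
    have hbn : b n ^ 2 ≤ L n ^ 2 := by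
      have := hb n (by omega)
      have := hb0 n
      gcongr
    have hGn : G n ≤ n * L n ^ 2 := by
      calc G n ≤ ∑ j ∈ Finset.range n, L n ^ 2 := by
            refine Finset.sum_le_sum fun j hj => ?_
            rw [Finset.mem_range] at hj
            have h1 := hb j (by omega)
            have h2 := hL hj.le
            have h3 := hb0 j
            gcongr
            linarith
        _ = n * L n ^ 2 := by simp
    set z : ℝ := 1 + n * L n ^ 2 / L 0 ^ 2 with hz
    have hz1 : 1 ≤ z := by
      have : 0 ≤ n * L n ^ 2 / L 0 ^ 2 := by positivity
      linarith
    set A : ℝ := 1 + G n / L 0 ^ 2 with hA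
    set B : ℝ := 1 + G (n + 1) / L 0 ^ 2 with hB
    have hAB : B - A = b n ^ 2 / L 0 ^ 2 := by rw [hA, hB, hGs]; ring
    have hAB' : A ≤ B := by
      have : 0 ≤ b n ^ 2 / L 0 ^ 2 := by positivity
      linarith
    -- For n ≥ 1 this is n + 1 ≤ 2n; for n = 0 the leading 1 in z absorbs b_0².
    have hBz : B ≤ 2 * z := by
      rcases Nat.eq_zero_or_pos n with rfl | hn
      · have e : G 1 ≤ L 0 ^ 2 := by rw [hGs]; simpa [hG] using hbn
        have : G 1 / L 0 ^ 2 ≤ 1 := (div_le_one (by positivity)).2 e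
        simp only [hB, hz, zero_add]
        simp
        linarith
      · have hn' : (1 : ℝ) ≤ n := by exact_mod_cast hn
        have : G (n + 1) / L 0 ^ 2 ≤ (2 * (n * L n ^ 2)) / L 0 ^ 2 := by
          gcongr
          rw [hGs]
          nlinarith [sq_nonneg (L n)]
        rw [hB, hz]
        have e : (2 * (n * L n ^ 2)) / L 0 ^ 2 = 2 * (n * L n ^ 2 / L 0 ^ 2) := by ring
        linarith
    have hlz := one_le_logPlus hz1
    have hlB := one_le_logPlus (hone (n + 1))
    have hlog : logPlus B ≤ 2 * logPlus z := by
      have h1 : Real.log B ≤ Real.log (2 * z) := Real.log_le_log (by linarith [hone (n + 1)]) hBz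
      rw [Real.log_mul two_ne_zero (by linarith)] at h1
      have h2 := Real.log_two_lt_d9
      unfold logPlus at hlz ⊢
      linarith
    -- The summand 16 L_n² pays both for L_0² and for the current b_n², which the partial sum G n
    -- omits.
    have hden : L 0 ^ 2 * B ≤ G n + 16 * L n ^ 2 := by
      have e : L 0 ^ 2 * B = L 0 ^ 2 + G (n + 1) := by rw [hB]; field_simp
      have : L 0 ^ 2 ≤ L n ^ 2 := by gcongr
      rw [e, hGs]
      nlinarith
    have hBpos : 0 < B := by linarith [hone (n + 1)]
    have hterm : b n ^ 2 / (logPlus z ^ 2 * (G n + 16 * L n ^ 2)) ≤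
        4 * ((B - A) / (B * logPlus B ^ 2)) := by
      have hlBpos : 0 < logPlus B := by linarith
      calc b n ^ 2 / (logPlus z ^ 2 * (G n + 16 * L n ^ 2))
          ≤ b n ^ 2 / ((logPlus B / 2) ^ 2 * (L 0 ^ 2 * B)) := by
            gcongr
            linarith
        _ = 4 * ((B - A) / (B * logPlus B ^ 2)) := by
            rw [hAB]
            field_simp
            norm_num
    have := sub_div_mul_logPlus_sq_le (hone n) hAB'
    linarith

/-! ### Stopped step sizes -/

/-- The T-DoG step size, set to `0` from the moment on where the iterates leave the ball of
radius `R` around the initial point. -/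
noncomputable def stoppedStep {m : ℕ} (ℓ : Euc m → ℝ) (rε θ R : ℝ) (x g : ℕ → Euc m) (t : ℕ) : ℝ :=
  if rBar rε x t ≤ R then tdogStep ℓ rε θ x g t else 0

theorem one_le_logPlus_arg {m : ℕ} (ℓ : Euc m → ℝ) (x : ℕ → Euc m) (t : ℕ) :
    1 ≤ logPlus (1 + t * lBar ℓ x t ^ 2 / lBar ℓ x 0 ^ 2) :=
  one_le_logPlus (by
    have : 0 ≤ t * lBar ℓ x t ^ 2 / lBar ℓ x 0 ^ 2 := by positivity
    linarith)

theorem gradSqSumBefore_nonneg {m : ℕ} (g : ℕ → Euc m) (t : ℕ) : 0 ≤ gradSqSumBefore g t :=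
  Finset.sum_nonneg fun _ _ => sq_nonneg _

theorem tdogG_nonneg {m : ℕ} (ℓ : Euc m → ℝ) (θ : ℝ) (x g : ℕ → Euc m) (t : ℕ) :
    0 ≤ tdogG ℓ θ x g t := by
  have := gradSqSumBefore_nonneg g t
  unfold tdogG
  positivity

theorem stoppedStep_nonneg {m : ℕ} {ℓ : Euc m → ℝ} {rε θ R : ℝ} {x g : ℕ → Euc m} {t : ℕ}
    (hr : 0 < rε) : 0 ≤ stoppedStep ℓ rε θ R x g t := by
  unfold stoppedStep tdogStep
  split_ifs
  · exact div_nonneg (hr.le.trans (le_max_right _ _)) (Real.sqrt_nonneg _)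
  · exact le_rfl

/-- The constant is 256 = √(8⁴ · 16), after dropping the logarithm and the past gradients. The
vector `v` is arbitrary because the bound is applied to every possible oracle response, not only to
the observed `g t`. -/
theorem stoppedStep_mul_norm_le {m : ℕ} {ℓ : Euc m → ℝ} {rε θ R : ℝ} {x g : ℕ → Euc m} {t : ℕ}
    (hr : 0 < rε) (hθ : 0 < θ) (hR : 0 ≤ R) {v : Euc m} (hv : ‖v‖ ≤ ℓ (x t)) :
    stoppedStep ℓ rε θ R x g t * ‖v‖ ≤ R / (256 * θ) := by
  have hnn : 0 ≤ R / (256 * θ) := by positivity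
  unfold stoppedStep
  split_ifs with h
  · rcases (norm_nonneg v).eq_or_lt with h0 | h0
    · simpa [← h0] using hnn
    have hvL := hv.trans (le_lBar ℓ x t)
    set L := lBar ℓ x t with hL
    have hLpos : 0 < L := h0.trans_le hvL
    have hsq : 256 * θ * L ≤ √(tdogG ℓ θ x g t) := by
      apply Real.le_sqrt_of_sq_le
      have h1 := one_le_logPlus_arg ℓ x t
      have h2 := gradSqSumBefore_nonneg g t
      calc (256 * θ * L) ^ 2 = 8 ^ 4 * θ ^ 2 * 1 ^ 2 * (0 + 16 * L ^ 2) := by ring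
        _ ≤ tdogG ℓ θ x g t := by
          unfold tdogG
          rw [← hL]
          gcongr
    have hr0 : 0 ≤ rBar rε x t := hr.le.trans (le_max_right _ _)
    calc tdogStep ℓ rε θ x g t * ‖v‖ ≤ R / (256 * θ * L) * L := by
          unfold tdogStep
          gcongr
      _ = R / (256 * θ) := by field_simp
  · simpa using hnn

theorem stoppedStep_sq_mul_le {m : ℕ} {ℓ : Euc m → ℝ} {rε θ R : ℝ} {x g : ℕ → Euc m} {t : ℕ}
    (hr : 0 < rε) (hθ : 0 < θ) :
    stoppedStep ℓ rε θ R x g t ^ 2 * ‖g t‖ ^ 2 ≤ R ^ 2 / (4096 * θ ^ 2) *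
      (‖g t‖ ^ 2 / (logPlus (1 + t * lBar ℓ x t ^ 2 / lBar ℓ x 0 ^ 2) ^ 2 *
      (∑ j ∈ Finset.range t, ‖g j‖ ^ 2 + 16 * lBar ℓ x t ^ 2))) := by
  unfold stoppedStep
  split_ifs with h
  · have hr0 : 0 ≤ rBar rε x t := hr.le.trans (le_max_right _ _)
    have hnn := tdogG_nonneg ℓ θ x g t
    calc tdogStep ℓ rε θ x g t ^ 2 * ‖g t‖ ^ 2
        = rBar rε x t ^ 2 / tdogG ℓ θ x g t * ‖g t‖ ^ 2 := by
          rw [tdogStep, div_pow, Real.sq_sqrt hnn]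
      _ ≤ R ^ 2 / tdogG ℓ θ x g t * ‖g t‖ ^ 2 := by gcongr
      _ = _ := by
          rw [tdogG, gradSqSumBefore, div_mul_div_comm, div_mul_eq_mul_div]
          congr 1
          ring
  · have := gradSqSumBefore_nonneg g t
    unfold gradSqSumBefore at this
    simp only [ne_eq, OfNat.ofNat_ne_zero, not_false_eq_true, zero_pow, zero_mul]
    positivity

/-! ### Trajectory estimates up to the first exit -/

theorem IsTDoG.eq_init {m : ℕ} {X : Set (Euc m)} {ℓ : Euc m → ℝ} {rε θ : ℝ} {x₀ : Euc m} {T : ℕ}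
    {x g : ℕ → Euc m} (h : IsTDoG X ℓ rε θ x₀ T x g) (hX : Convex ℝ X) (hx₀ : x₀ ∈ X)
    (hg : ∀ t < T, ‖g t‖ ≤ ℓ (x t)) (h0 : ℓ x₀ ≤ 0) : ∀ t ≤ T, x t = x₀ := by
  intro t
  induction t with
  | zero => exact fun _ => h.init
  | succ t ih =>
    intro ht
    have e := ih (by omega)
    have hgt := hg t ht
    rw [e] at hgt
    have hz : g t = 0 := norm_le_zero_iff.1 (hgt.trans h0)
    have hs := h.step t ht
    rw [hz, smul_zero, sub_zero, e] at hs
    exact hs.unique hX (isEuclideanProj_self hx₀)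

theorem IsTDoG.sum_stoppedStep_sq_le {m : ℕ} {X : Set (Euc m)} {ℓ : Euc m → ℝ} {rε θ R : ℝ}
    {x₀ : Euc m} {T : ℕ} {x g : ℕ → Euc m} (h : IsTDoG X ℓ rε θ x₀ T x g) (hX : Convex ℝ X)
    (hx₀ : x₀ ∈ X) (hg : ∀ t < T, ‖g t‖ ≤ ℓ (x t)) (hr : 0 < rε) (hθ : 0 < θ) {n : ℕ}
    (hn : n ≤ T) :
    ∑ t ∈ Finset.range n, stoppedStep ℓ rε θ R x g t ^ 2 * ‖g t‖ ^ 2 ≤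
      R ^ 2 / (4096 * θ ^ 2) * 4 := by
  -- The logarithmic sum needs ℓ(x_0) > 0. Otherwise the iterates never move and all responses
  -- vanish.
  rcases le_or_gt (ℓ x₀) 0 with h0 | h0
  · rw [Finset.sum_eq_zero]
    · positivity
    intro t ht
    rw [Finset.mem_range] at ht
    have hgt := hg t (by omega)
    rw [h.eq_init hX hx₀ hg h0 t (by omega)] at hgt
    rw [norm_le_zero_iff.1 (hgt.trans h0)]
    simp
  · refine (Finset.sum_le_sum fun t _ => stoppedStep_sq_mul_le hr hθ).trans ?_
    rw [← Finset.mul_sum]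
    gcongr
    refine sum_sq_div_logPlus_sq_le (lBar_mono ℓ x) ?_ (fun _ => norm_nonneg _) fun k hk => ?_
    · rw [lBar_zero, h.init]
      exact h0
    · exact (hg k (by omega)).trans (le_lBar ℓ x k)

theorem IsTDoG.mem {m : ℕ} {X : Set (Euc m)} {ℓ : Euc m → ℝ} {rε θ : ℝ} {x₀ : Euc m} {T : ℕ}
    {x g : ℕ → Euc m} (h : IsTDoG X ℓ rε θ x₀ T x g) (hx₀ : x₀ ∈ X) : ∀ t ≤ T, x t ∈ X
  | 0, _ => h.init ▸ hx₀
  | t + 1, ht => (h.step t ht).1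

/-- The iterates stay within distance `3 d₀` as long as the stopped sum of the terms
`-η_t ⟪g_t, x_t - x_⋆⟫` is at most `d₀²`. -/
theorem IsTDoG.rBar_le {m : ℕ} {X : Set (Euc m)} {ℓ : Euc m → ℝ} {rε θ : ℝ}
    {x₀ xs : Euc m} {T : ℕ} {x g : ℕ → Euc m} (h : IsTDoG X ℓ rε θ x₀ T x g) (hX : Convex ℝ X)
    (hx₀ : x₀ ∈ X) (hxs : xs ∈ X) (hg : ∀ t < T, ‖g t‖ ≤ ℓ (x t)) (hr : 0 < rε) (hθ : 1 ≤ θ)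
    (hrd : rε ≤ 3 * ‖x₀ - xs‖)
    (hS : ∑ t ∈ Finset.range T,
      -inner ℝ (g t) (stoppedStep ℓ rε θ (3 * ‖x₀ - xs‖) x g t • (x t - xs)) ≤ ‖x₀ - xs‖ ^ 2) :
    rBar rε x T ≤ 3 * ‖x₀ - xs‖ := by
  classical
  by_contra hT
  set d := ‖x₀ - xs‖ with hd
  have hex : ∃ n, ¬ rBar rε x n ≤ 3 * d := ⟨T, hT⟩
  obtain ⟨n, hn, hmin⟩ : ∃ n, ¬ rBar rε x n ≤ 3 * d ∧ ∀ k < n, rBar rε x k ≤ 3 * d :=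
    ⟨Nat.find hex, Nat.find_spec hex, fun k hk => not_not.1 (Nat.find_min hex hk)⟩
  have hnT : n ≤ T := by
    by_contra! hlt
    exact hT (hmin T hlt)
  have hdesc : ∀ j ≤ n, ‖x j - xs‖ ^ 2 ≤ d ^ 2 +
      2 * ∑ t ∈ Finset.range j,
        -inner ℝ (g t) (stoppedStep ℓ rε θ (3 * d) x g t • (x t - xs)) +
      ∑ t ∈ Finset.range j, stoppedStep ℓ rε θ (3 * d) x g t ^ 2 * ‖g t‖ ^ 2 := by
    intro j
    induction j with
    | zero => intro _; simp [h.init, hd]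
    | succ j ih =>
      intro hj
      have h1 := ih (by omega)
      have h2 := (h.step j (by omega)).sq_norm_sub_le hX hxs
      have e : tdogStep ℓ rε θ x g j = stoppedStep ℓ rε θ (3 * d) x g j := by
        rw [stoppedStep, if_pos (hmin j hj)]
      rw [e] at h2
      rw [Finset.sum_range_succ, Finset.sum_range_succ]
      linarith
  have hsum : ∑ t ∈ Finset.range n,
        -inner ℝ (g t) (stoppedStep ℓ rε θ (3 * d) x g t • (x t - xs)) =
      ∑ t ∈ Finset.range T,
        -inner ℝ (g t) (stoppedStep ℓ rε θ (3 * d) x g t • (x t - xs)) := by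
    -- From the exit time n on, r̄_t stays above 3d by monotonicity, so the additional stopped terms
    -- are zero.
    refine Finset.sum_subset (Finset.range_mono hnT) fun t _ ht => ?_
    rw [Finset.mem_range, not_lt] at ht
    have : ¬ rBar rε x t ≤ 3 * d := fun hle => hn ((rBar_mono rε x ht).trans hle)
    simp [stoppedStep, this]
  have hsq := h.sum_stoppedStep_sq_le (R := 3 * d) hX hx₀ hg hr (by linarith) hnT
  have hsmall : (3 * d) ^ 2 / (4096 * θ ^ 2) * 4 ≤ d ^ 2 := by
    have h1 : (1 : ℝ) ≤ θ ^ 2 := one_le_pow₀ hθ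
    calc (3 * d) ^ 2 / (4096 * θ ^ 2) * 4 ≤ (3 * d) ^ 2 / (4096 * 1) * 4 := by gcongr
      _ ≤ d ^ 2 := by nlinarith [sq_nonneg d]
  have hfin := hdesc n le_rfl
  rw [hsum] at hfin
  -- The three contributions are d², at most 2d² from the first-order sum, and at most d² from the
  -- second-order sum.
  have h4 : ‖x n - xs‖ ^ 2 ≤ (2 * d) ^ 2 := by nlinarith
  have h5 : ‖x n - xs‖ ≤ 2 * d :=
    le_of_sq_le_sq h4 (by have := norm_nonneg (x₀ - xs); linarith)
  refine hn (rBar_le_iff.2 ⟨fun k hk => ?_, hrd⟩)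
  rcases hk.lt_or_eq with hk | rfl
  · exact (rBar_le_iff.1 (hmin k hk)).1 k le_rfl
  · have h6 := norm_sub_le_norm_sub_add_norm_sub (x k) xs (x 0)
    rw [norm_sub_rev xs, h.init] at h6
    rw [h.init]
    linarith

theorem inner_sub_nonneg_of_mem_subdifferential {m : ℕ} {X : Set (Euc m)} {f : Euc m → ℝ}
    {xs x v : Euc m} (hxs : xs ∈ X) (hmin : IsMinOn f X xs) (hx : x ∈ X)
    (hv : v ∈ subdifferential X f x) : 0 ≤ inner ℝ v (x - xs) := by
  have h1 := hv xs hxs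
  have h2 : f xs ≤ f x := hmin hx
  rw [← neg_sub x xs, inner_neg_right] at h1
  linarith

/-- For T ≥ 1 one has log(6T) ≥ 1, and e⁴ < 60. This is all that the argument uses about θ. -/
theorem four_add_log_inv_le_timeUniformLog {T : ℕ} (hT : 1 ≤ T) {δ : ℝ} (hδ : 0 < δ) :
    4 + Real.log δ⁻¹ ≤ timeUniformLog T δ := by
  have hT' : (1 : ℝ) ≤ T := by exact_mod_cast hT
  have h1 : 1 ≤ Real.log (6 * (T : ℝ)) := by
    rw [Real.le_log_iff_exp_le (by linarith)]
    linarith [Real.exp_one_lt_d9]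
  have h2 : (4 : ℝ) ≤ Real.log (60 * Real.log (6 * (T : ℝ))) := by
    rw [Real.le_log_iff_exp_le (by linarith)]
    have h3 : Real.exp 4 = Real.exp 1 ^ 4 := by
      rw [← Real.exp_nat_mul]
      norm_num
    have h4 : Real.exp 1 ^ 4 ≤ 2.75 ^ 4 := by
      gcongr
      linarith [Real.exp_one_lt_d9]
    rw [h3]
    norm_num at h4 ⊢
    linarith
  rw [timeUniformLog, div_eq_mul_inv, Real.log_mul (by linarith) (inv_ne_zero hδ.ne')]
  linarith

/-! ### Measurability of the iterates -/

/-- Outside X the function ℓ is arbitrary and possibly not measurable, so measurability of ℓ(x_t)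
has to go through the subtype X. -/
theorem ContinuousOn.measurable_comp_of_forall_mem {Ω α β : Type*} [MeasurableSpace Ω]
    [TopologicalSpace α] [MeasurableSpace α] [BorelSpace α] [TopologicalSpace β]
    [MeasurableSpace β] [BorelSpace β] {s : Set α} {f : α → β} (hf : ContinuousOn f s) {y : Ω → α}
    (hy : Measurable y) (hs : ∀ ω, y ω ∈ s) : Measurable fun ω => f (y ω) :=
  hf.domRestrict.measurable.comp (hy.subtype_mk (h := hs))

theorem measurable_stoppedStep {m : ℕ} {Ω : Type*} [MeasurableSpace Ω] {ℓ : Euc m → ℝ}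
    (rε θ R : ℝ) {x g : ℕ → Ω → Euc m} {t : ℕ} (hx : ∀ k ≤ t, Measurable (x k))
    (hℓ : ∀ k ≤ t, Measurable fun ω => ℓ (x k ω)) (hg : ∀ k < t, Measurable (g k)) :
    Measurable (fun ω => tdogStep ℓ rε θ (fun k => x k ω) (fun k => g k ω) t) ∧
      Measurable (fun ω => stoppedStep ℓ rε θ R (fun k => x k ω) (fun k => g k ω) t) := by
  have hr : Measurable fun ω => rBar rε (fun k => x k ω) t := by
    refine Measurable.max (Finset.measurable_range_sup'' fun k hk => ?_) measurable_const
    exact ((hx k hk).sub (hx 0 (Nat.zero_le t))).norm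
  have hl : Measurable fun ω => lBar ℓ (fun k => x k ω) t := Finset.measurable_range_sup'' hℓ
  have hl0 : Measurable fun ω => lBar ℓ (fun k => x k ω) 0 :=
    Finset.measurable_range_sup'' fun k hk => hℓ k (hk.trans (Nat.zero_le t))
  have hG : Measurable fun ω => gradSqSumBefore (fun k => g k ω) t :=
    Finset.measurable_sum _ fun k hk => ((hg k (Finset.mem_range.1 hk)).norm.pow_const 2)
  have hstep : Measurable fun ω => tdogStep ℓ rε θ (fun k => x k ω) (fun k => g k ω) t := by
    unfold tdogStep tdogG logPlus
    fun_prop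
  exact ⟨hstep, Measurable.ite (measurableSet_le hr measurable_const) hstep measurable_const⟩

theorem measurable_gradHistory {m : ℕ} {Ω : Type*} (g : ℕ → Ω → Euc m) {k t : ℕ} (hkt : k < t) :
    Measurable[gradHistory g t] (g k) :=
  (comap_measurable (g k)).mono
    (le_iSup₂_of_le (f := fun k _ => MeasurableSpace.comap (g k) inferInstance) k
      (Finset.mem_range.2 hkt) le_rfl) le_rfl

theorem gradHistory_mono {m : ℕ} {Ω : Type*} (g : ℕ → Ω → Euc m) {s t : ℕ} (hst : s ≤ t) :
    gradHistory g s ≤ gradHistory g t :=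
  biSup_mono fun _ hk => Finset.range_mono hst hk

theorem gradHistory_le {m : ℕ} {Ω : Type*} [MeasurableSpace Ω] {g : ℕ → Ω → Euc m} {t : ℕ}
    (hg : ∀ k < t, Measurable (g k)) : gradHistory g t ≤ ‹MeasurableSpace Ω› :=
  iSup₂_le fun k hk => (hg k (Finset.mem_range.1 hk)).comap_le

theorem measurable_iterate {m : ℕ} {Ω : Type*} {X : Set (Euc m)} (hc : IsClosed X)
    (hX : Convex ℝ X) {ℓ : Euc m → ℝ} (hℓ : ContinuousOn ℓ X) {rε θ : ℝ} {x₀ : Euc m}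
    (hx₀ : x₀ ∈ X) {T : ℕ} {x g : ℕ → Ω → Euc m}
    (h : ∀ ω, IsTDoG X ℓ rε θ x₀ T (fun t => x t ω) (fun t => g t ω)) :
    ∀ t ≤ T, Measurable[gradHistory g t] (x t) := by
  obtain ⟨P, hP, hproj⟩ := exists_measurable_isEuclideanProj hc ⟨x₀, hx₀⟩ hX
  intro t
  induction t using Nat.strong_induction_on with
  | _ t ih =>
    intro ht
    cases t with
    | zero =>
      have : x 0 = fun _ => x₀ := funext fun ω => (h ω).init
      rw [this]
      exact measurable_const
    | succ t =>
      let _ : MeasurableSpace Ω := gradHistory g (t + 1)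
      have hx : ∀ k ≤ t, Measurable (x k) := fun k hk =>
        (ih k (by omega) (by omega)).mono (gradHistory_mono g (by omega)) le_rfl
      have hg : ∀ k ≤ t, Measurable (g k) := fun k hk => measurable_gradHistory g (by omega)
      -- The radius 0 is a dummy value: only the unstopped component is used.
      have hs := (measurable_stoppedStep rε θ 0 hx
        (fun k hk => hℓ.measurable_comp_of_forall_mem (hx k hk)
          fun ω => (h ω).mem hx₀ k (by omega)) fun k hk => hg k hk.le).1
      have e : x (t + 1) = fun ω => P (x t ω -
          tdogStep ℓ rε θ (fun k => x k ω) (fun k => g k ω) t • g t ω) :=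
        funext fun ω => ((h ω).step t ht).unique hX (hproj _)
      rw [e]
      exact hP.comp ((hx t le_rfl).sub (hs.smul (hg t le_rfl)))

/-! ### Integration against conditional laws -/

/-- The joint law of (Y, G) is the composition product of the law of Y with κ. On a rectangle A × B
this is the defining property of conditional expectation, tested on the event Y ∈ A. -/
theorem lintegral_pair_eq_of_condExp {Ω E F : Type*} {m m0 : MeasurableSpace Ω}
    [MeasurableSpace E] [MeasurableSpace F] {μ : Measure Ω} [IsProbabilityMeasure μ] (hm : m ≤ m0)
    (κ : Kernel E F) [IsMarkovKernel κ] {Y : Ω → E} {G : Ω → F} (hY : Measurable[m] Y)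
    (hG : Measurable G)
    (h : ∀ B, MeasurableSet B → μ⟦G ⁻¹' B | m⟧ =ᵐ[μ] fun ω => (κ (Y ω)).real B)
    {Φ : E × F → ENNReal} (hΦ : Measurable Φ) :
    ∫⁻ ω, Φ (Y ω, G ω) ∂μ = ∫⁻ ω, ∫⁻ v, Φ (Y ω, v) ∂κ (Y ω) ∂μ := by
  have hY0 : Measurable Y := hY.mono hm le_rfl
  have hlaw : μ.map (fun ω => (Y ω, G ω)) = (μ.map Y) ⊗ₘ κ := by
    have : IsProbabilityMeasure (μ.map Y) := Measure.isProbabilityMeasure_map hY0.aemeasurable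
    have : IsProbabilityMeasure (μ.map fun ω => (Y ω, G ω)) :=
      Measure.isProbabilityMeasure_map (hY0.prodMk hG).aemeasurable
    refine Measure.ext_prod fun {A B} hA hB => ?_
    rw [Measure.map_apply (hY0.prodMk hG) (hA.prod hB), Measure.compProd_apply_prod hA hB,
      setLIntegral_map hA (κ.measurable_coe hB) hY0]
    have hpre : (fun ω => (Y ω, G ω)) ⁻¹' A ×ˢ B = G ⁻¹' B ∩ Y ⁻¹' A := by
      ext ω
      simp [and_comm]
    have hint : Integrable ((G ⁻¹' B).indicator fun _ => (1 : ℝ)) μ :=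
      (integrable_const 1).indicator (hG hB)
    have h1 := setIntegral_condExp hm hint (hY hA)
    rw [integral_indicator (hG hB), Measure.restrict_restrict (hG hB), integral_const,
      setIntegral_congr_ae (hY0 hA) ((h B hB).mono fun _ hω _ => hω)] at h1
    simp only [measureReal_restrict_apply_univ, smul_eq_mul, mul_one] at h1
    have hmeas : Measurable fun ω => κ (Y ω) B := (κ.measurable_coe hB).comp hY0
    simp only [measureReal_def] at h1
    rw [integral_toReal hmeas.aemeasurable (ae_of_all _ fun ω => measure_lt_top _ _)] at h1
    rw [hpre]
    refine ((ENNReal.toReal_eq_toReal_iff' ?_ (measure_ne_top _ _)).1 h1).symm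
    refine ne_top_of_le_ne_top (measure_ne_top μ (Y ⁻¹' A)) ?_
    calc ∫⁻ ω in Y ⁻¹' A, κ (Y ω) B ∂μ ≤ ∫⁻ ω in Y ⁻¹' A, 1 ∂μ :=
          lintegral_mono fun ω => prob_le_one
      _ = μ (Y ⁻¹' A) := by simp
  calc ∫⁻ ω, Φ (Y ω, G ω) ∂μ = ∫⁻ z, Φ z ∂(μ.map fun ω => (Y ω, G ω)) :=
        (lintegral_map hΦ (hY0.prodMk hG)).symm
    _ = ∫⁻ y, ∫⁻ v, Φ (y, v) ∂κ y ∂(μ.map Y) := by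
        rw [hlaw, Measure.lintegral_compProd hΦ]
    _ = _ := lintegral_map hΦ.lintegral_kernel_prod_right' hY0

/-! ### The exponential supermartingale and almost sure bounds -/

theorem exp_sub_sq_le_one_add {u : ℝ} (hu : |u| ≤ 3 / 8) : Real.exp (u - u ^ 2) ≤ 1 + u := by
  obtain ⟨h1, h2⟩ := abs_le.1 hu
  rcases le_total 0 u with h0 | h0
  · have h3 := Real.one_sub_le_exp_neg (u - u ^ 2)
    rw [Real.exp_neg] at h3
    have h4 : 0 < 1 - (u - u ^ 2) := by nlinarith
    have h5 : Real.exp (u - u ^ 2) ≤ (1 - (u - u ^ 2))⁻¹ := (le_inv_comm₀ h4 (Real.exp_pos _)).1 h3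
    -- The remaining claim is (1 + u)(1 - u + u²) = 1 + u³ ≥ 1.
    refine h5.trans ((inv_le_iff_one_le_mul₀ h4).2 ?_)
    nlinarith [pow_nonneg h0 3]
  · set y := u ^ 2 - u with hy
    have hy0 : 0 ≤ y := by nlinarith
    have h3 := Real.quadratic_le_exp_of_nonneg hy0
    have h4 : 0 < 1 + y + y ^ 2 / 2 := by positivity
    rw [show u - u ^ 2 = -y by ring, Real.exp_neg]
    refine (inv_anti₀ h4 h3).trans ((inv_le_iff_one_le_mul₀ h4).2 ?_)
    -- Since y² = u²(1 - u)², this amounts to (1 - u)² ≤ 2, which holds for u ≥ -3/8. The next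
    -- product equals 1 + y⁴/4.
    have h5 : 1 - y + y ^ 2 / 2 ≤ 1 + u := by
      have : (1 - u) ^ 2 ≤ 2 := by nlinarith
      nlinarith [mul_nonneg (sq_nonneg u) (sub_nonneg.2 this)]
    have h6 : 1 ≤ (1 - y + y ^ 2 / 2) * (1 + y + y ^ 2 / 2) := by
      nlinarith [sq_nonneg (y ^ 2)]
    nlinarith

/-- One step of the supermartingale: the integrand is at most 1 - ⟪v, w⟫, whose mean is at most 1 by
the sign condition on the mean of ν. -/
theorem lintegral_exp_neg_inner_sub_sq_le_one {m : ℕ} {ν : Measure (Euc m)}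
    [IsProbabilityMeasure ν] (hν : Integrable (fun v => v) ν) {w : Euc m}
    (hb : ∀ᵐ v ∂ν, |inner ℝ v w| ≤ 3 / 8) (hw : 0 ≤ inner ℝ (∫ v, v ∂ν) w) :
    ∫⁻ v, ENNReal.ofReal (Real.exp (-inner ℝ v w - inner ℝ v w ^ 2)) ∂ν ≤ 1 := by
  have hi : Integrable (fun v => inner ℝ v w) ν := hν.inner_const w
  have hle : ∀ᵐ v ∂ν, Real.exp (-inner ℝ v w - inner ℝ v w ^ 2) ≤ 1 - inner ℝ v w := by
    filter_upwards [hb] with v hv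
    have := exp_sub_sq_le_one_add (u := -inner ℝ v w) (by rwa [abs_neg])
    rwa [neg_sq, ← sub_eq_add_neg] at this
  calc ∫⁻ v, ENNReal.ofReal (Real.exp (-inner ℝ v w - inner ℝ v w ^ 2)) ∂ν
      ≤ ∫⁻ v, ENNReal.ofReal (1 - inner ℝ v w) ∂ν :=
        lintegral_mono_ae (hle.mono fun v hv => ENNReal.ofReal_le_ofReal hv)
    _ = ENNReal.ofReal (∫ v, (1 - inner ℝ v w) ∂ν) :=
        (ofReal_integral_eq_lintegral_ofReal ((integrable_const 1).sub hi)
          (hle.mono fun v hv => (Real.exp_pos _).le.trans hv)).symm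
    _ ≤ 1 := by
        have e : ∫ v, inner ℝ v w ∂ν = inner ℝ (∫ v, v ∂ν) w := by
          rw [real_inner_comm, ← integral_inner hν w]
          simp only [real_inner_comm]
        rw [integral_sub (integrable_const 1) hi, e]
        simpa using hw

/-- The exponential supermartingale of an adapted sequence of oracle responses. -/
theorem lintegral_exp_sum_le_one {m : ℕ} {Ω : Type*} [MeasurableSpace Ω] {μ : Measure Ω}
    [IsProbabilityMeasure μ] {O : Kernel (Euc m) (Euc m)} [IsMarkovKernel O] {T : ℕ}
    {x g w : ℕ → Ω → Euc m} (hresp : IsOracleResponse μ O T x g)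
    (hx : ∀ t < T, Measurable[gradHistory g t] (x t))
    (hw : ∀ t < T, Measurable[gradHistory g t] (w t))
    (hint : ∀ t < T, ∀ ω, Integrable (fun v => v) (O (x t ω)))
    (hb : ∀ t < T, ∀ ω, ∀ᵐ v ∂O (x t ω), |inner ℝ v (w t ω)| ≤ 3 / 8)
    (hmean : ∀ t < T, ∀ ω, 0 ≤ inner ℝ (∫ v, v ∂O (x t ω)) (w t ω)) {n : ℕ} (hn : n ≤ T) :
    ∫⁻ ω, ENNReal.ofReal (Real.exp (∑ t ∈ Finset.range n,
      (-inner ℝ (g t ω) (w t ω) - inner ℝ (g t ω) (w t ω) ^ 2))) ∂μ ≤ 1 := by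
  induction n with
  | zero => simp
  | succ n ih =>
    set S : Ω → ℝ := fun ω => ∑ t ∈ Finset.range n,
      (-inner ℝ (g t ω) (w t ω) - inner ℝ (g t ω) (w t ω) ^ 2) with hS
    have hSm : Measurable[gradHistory g n] S := by
      let _ : MeasurableSpace Ω := gradHistory g n
      refine Finset.measurable_sum _ fun t ht => ?_
      rw [Finset.mem_range] at ht
      have h1 : Measurable (g t) := measurable_gradHistory g ht
      have h2 : Measurable (w t) :=
        (hw t (by omega)).mono (gradHistory_mono g ht.le) le_rfl
      exact (h1.inner h2).neg.sub ((h1.inner h2).pow_const 2)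
    have hle : gradHistory g n ≤ ‹MeasurableSpace Ω› :=
      gradHistory_le fun k hk => hresp.measurable k (by omega)
    -- The triple collects everything the new factor needs from the past; the kernel reads only its
    -- last coordinate, the query point.
    have hY : Measurable[gradHistory g n] fun ω => (S ω, w n ω, x n ω) :=
      hSm.prodMk ((hw n hn).prodMk (hx n hn))
    let Φ : (ℝ × Euc m × Euc m) × Euc m → ENNReal := fun z =>
      ENNReal.ofReal (Real.exp z.1.1) *
        ENNReal.ofReal (Real.exp (-inner ℝ z.2 z.1.2.1 - inner ℝ z.2 z.1.2.1 ^ 2))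
    have hΦ : Measurable Φ := by fun_prop
    have hκ : Measurable fun y : ℝ × Euc m × Euc m => y.2.2 := by fun_prop
    have key := lintegral_pair_eq_of_condExp hle (O.comap _ hκ) hY (hresp.measurable n hn)
      (hresp.condLaw n hn) hΦ
    calc _ = ∫⁻ ω, Φ ((S ω, w n ω, x n ω), g n ω) ∂μ := by
          refine lintegral_congr fun ω => ?_
          rw [Finset.sum_range_succ, Real.exp_add, ENNReal.ofReal_mul (Real.exp_pos _).le]
      _ = _ := key
      _ ≤ ∫⁻ ω, ENNReal.ofReal (Real.exp (S ω)) ∂μ := by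
          refine lintegral_mono fun ω => ?_
          simp only [Φ, Kernel.comap_apply]
          rw [lintegral_const_mul _ (by fun_prop)]
          exact mul_le_of_le_one_right' (lintegral_exp_neg_inner_sub_sq_le_one
            (hint n hn ω) (hb n hn ω) (hmean n hn ω))
      _ ≤ 1 := ih (by omega)

/-- Transfers the almost sure bound from the conditional laws to the actual responses by integrating
the indicator of the bad event. The value ℓ(x_t) is carried as a separate real coordinate, so that
the bad event is measurable although ℓ is controlled only on X. -/
theorem IsOracleResponse.ae_norm_le {m : ℕ} {Ω : Type*} [MeasurableSpace Ω] {μ : Measure Ω}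
    [IsProbabilityMeasure μ] {O : Kernel (Euc m) (Euc m)} [IsMarkovKernel O] {T : ℕ}
    {x g : ℕ → Ω → Euc m} (hresp : IsOracleResponse μ O T x g) {ℓ : Euc m → ℝ} {t : ℕ}
    (ht : t < T) (hx : Measurable[gradHistory g t] (x t))
    (hℓ : Measurable[gradHistory g t] fun ω => ℓ (x t ω))
    (hb : ∀ ω, ∀ᵐ v ∂O (x t ω), ‖v‖ ≤ ℓ (x t ω)) :
    ∀ᵐ ω ∂μ, ‖g t ω‖ ≤ ℓ (x t ω) := by
  have hle : gradHistory g t ≤ ‹MeasurableSpace Ω› :=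
    gradHistory_le fun k hk => hresp.measurable k (by omega)
  have hκ : Measurable fun y : ℝ × Euc m => y.2 := measurable_snd
  have hB : MeasurableSet {z : (ℝ × Euc m) × Euc m | z.1.1 < ‖z.2‖} :=
    measurableSet_lt (by fun_prop) (by fun_prop)
  have key := lintegral_pair_eq_of_condExp hle (O.comap _ hκ) (hℓ.prodMk hx)
    (hresp.measurable t ht) (hresp.condLaw t ht)
    (Φ := {z : (ℝ × Euc m) × Euc m | z.1.1 < ‖z.2‖}.indicator 1) (measurable_one.indicator hB)
  have hz : ∫⁻ ω, {z : (ℝ × Euc m) × Euc m | z.1.1 < ‖z.2‖}.indicator 1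
      ((ℓ (x t ω), x t ω), g t ω) ∂μ = 0 := by
    rw [key]
    simp only [Kernel.comap_apply]
    refine (lintegral_congr fun ω => ?_).trans lintegral_zero
    refine (lintegral_congr_ae ((hb ω).mono fun v hv => ?_)).trans lintegral_zero
    simpa using hv
  have hm : Measurable fun ω => {z : (ℝ × Euc m) × Euc m | z.1.1 < ‖z.2‖}.indicator
      (1 : (ℝ × Euc m) × Euc m → ENNReal) ((ℓ (x t ω), x t ω), g t ω) :=
    (measurable_one.indicator hB).comp
      (((hℓ.prodMk hx).mono hle le_rfl).prodMk (hresp.measurable t ht))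
  filter_upwards [(lintegral_eq_zero_iff hm).1 hz] with ω hω
  simpa using hω

/-! ### The probability bound and the proposition -/

theorem measure_rBar_gt_le {m : ℕ} {X : Set (Euc m)} {f : Euc m → ℝ} (hc : IsClosed X)
    (hX : Convex ℝ X) {xs : Euc m} (hxs : xs ∈ X) (hmin : IsMinOn f X xs) {x₀ : Euc m}
    (hx₀ : x₀ ∈ X) {rε : ℝ} (hrε : 0 < rε) (hrd : rε ≤ 3 * ‖x₀ - xs‖) {δ : ℝ} (hδ₀ : 0 < δ)
    (hδ₁ : δ < 1) {θ : ℝ} (hθ : 4 + Real.log δ⁻¹ ≤ θ) {T : ℕ} {O : Kernel (Euc m) (Euc m)}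
    {ℓ : Euc m → ℝ} (hO : IsStochasticGradientOracle X f O) (hℓ : IsPointwiseBound X O ℓ)
    {Ω : Type*} [MeasurableSpace Ω] {μ : Measure Ω} [IsProbabilityMeasure μ] {x g : ℕ → Ω → Euc m}
    (h : ∀ ω, IsTDoG X ℓ rε θ x₀ T (fun t => x t ω) (fun t => g t ω))
    (hresp : IsOracleResponse μ O T x g) :
    μ {ω | rBar rε (fun t => x t ω) T > 3 * ‖x₀ - xs‖} ≤ ENNReal.ofReal δ := by
  have := hO.markov
  set d := ‖x₀ - xs‖ with hd
  have hdpos : 0 < d := by linarith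
  have hlog : 0 < Real.log δ⁻¹ := Real.log_pos ((one_lt_inv₀ hδ₀).2 hδ₁)
  have hθ0 : 0 < θ := by linarith
  have hmem : ∀ t ≤ T, ∀ ω, x t ω ∈ X := fun t ht ω => (h ω).mem hx₀ t ht
  have hxm := measurable_iterate hc hX hℓ.continuousOn hx₀ h
  have hlm : ∀ t ≤ T, Measurable[gradHistory g t] fun ω => ℓ (x t ω) := fun t ht =>
    @ContinuousOn.measurable_comp_of_forall_mem Ω _ _ (gradHistory g t) _ _ _ _ _ _ _ _
      hℓ.continuousOn _ (hxm t ht) (hmem t ht)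
  set η : ℕ → Ω → ℝ := fun t ω =>
    stoppedStep ℓ rε θ (3 * d) (fun k => x k ω) (fun k => g k ω) t with hη
  have hηm : ∀ t ≤ T, Measurable[gradHistory g t] (η t) := fun t ht => by
    let _ : MeasurableSpace Ω := gradHistory g t
    exact (measurable_stoppedStep rε θ (3 * d)
      (fun k hk => (hxm k (hk.trans ht)).mono (gradHistory_mono g hk) le_rfl)
      (fun k hk => (hlm k (hk.trans ht)).mono (gradHistory_mono g hk) le_rfl)
      fun k hk => measurable_gradHistory g hk).2
  have hη0 : ∀ t ω, 0 ≤ η t ω := fun t ω => stoppedStep_nonneg hrε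
  have hdist : ∀ t ω, η t ω ≠ 0 → ‖x t ω - xs‖ ≤ 4 * d := fun t ω hne => by
    have hr : rBar rε (fun k => x k ω) t ≤ 3 * d := by
      by_contra hr
      exact hne (if_neg hr)
    have h1 := (rBar_le_iff.1 hr).1 t le_rfl
    have h2 := norm_sub_le_norm_sub_add_norm_sub (x t ω) (x 0 ω) xs
    have h3 : x 0 ω = x₀ := (h ω).init
    simp only [h3] at h1 h2
    linarith
  have hinner : ∀ t ω (v : Euc m), |inner ℝ v (η t ω • (x t ω - xs))| ≤
      4 * d * (η t ω * ‖v‖) := fun t ω v => by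
    rcases eq_or_ne (η t ω) 0 with h0 | h0
    · simp [h0]
    refine (abs_real_inner_le_norm _ _).trans ?_
    rw [norm_smul, Real.norm_of_nonneg (hη0 t ω)]
    have := mul_le_mul_of_nonneg_left (hdist t ω h0) (mul_nonneg (norm_nonneg v) (hη0 t ω))
    linarith
  -- This scale turns the threshold d² into 8θ, keeps each scaled term within 3/8, and bounds the
  -- sum of their squares by 9.
  set c : ℝ := 8 * θ / d ^ 2 with hcdef
  have hcpos : 0 < c := by positivity
  set w : ℕ → Ω → Euc m := fun t ω => c • η t ω • (x t ω - xs) with hw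
  have hwm : ∀ t < T, Measurable[gradHistory g t] (w t) := fun t ht =>
    ((hηm t ht.le).smul ((hxm t ht.le).sub_const xs)).const_smul c
  have hE := lintegral_exp_sum_le_one (w := w) hresp (fun t ht => hxm t ht.le) hwm
    (fun t ht ω => hO.integrable _ (hmem t ht.le ω))
    (fun t ht ω => by
      filter_upwards [hℓ.bound _ (hmem t ht.le ω)] with v hv
      have h1 : η t ω * ‖v‖ ≤ 3 * d / (256 * θ) :=
        stoppedStep_mul_norm_le hrε hθ0 (by positivity) hv
      simp only [hw]
      rw [inner_smul_right, abs_mul, abs_of_pos hcpos]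
      calc c * |inner ℝ v (η t ω • (x t ω - xs))| ≤ c * (4 * d * (3 * d / (256 * θ))) := by
            have := hinner t ω v
            gcongr
            exact this.trans (by gcongr)
        _ = 3 / 8 := by rw [hcdef]; field_simp; norm_num)
    (fun t ht ω => by
      simp only [hw]
      rw [inner_smul_right, inner_smul_right]
      exact mul_nonneg hcpos.le (mul_nonneg (hη0 t ω) (inner_sub_nonneg_of_mem_subdifferential hxs
        hmin (hmem t ht.le ω) (hO.mean_mem _ (hmem t ht.le ω))))) le_rfl
  have hgb : ∀ᵐ ω ∂μ, ∀ t < T, ‖g t ω‖ ≤ ℓ (x t ω) := by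
    rw [ae_all_iff]
    intro t
    by_cases ht : t < T
    · filter_upwards [hresp.ae_norm_le ht (hxm t ht.le) (hlm t ht.le)
        fun ω => hℓ.bound _ (hmem t ht.le ω)] with ω hω _ using hω
    · exact ae_of_all _ fun ω ht' => absurd ht' ht
  set Z : Ω → ENNReal := fun ω => ENNReal.ofReal (Real.exp (∑ t ∈ Finset.range T,
      (-inner ℝ (g t ω) (w t ω) - inner ℝ (g t ω) (w t ω) ^ 2))) with hZ
  have hZm : Measurable Z := by
    refine (Real.measurable_exp.comp (Finset.measurable_sum _ fun t ht => ?_)).ennreal_ofReal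
    rw [Finset.mem_range] at ht
    have h1 := hresp.measurable t ht
    have h2 : Measurable (w t) :=
      (hwm t ht).mono (gradHistory_le fun k hk => hresp.measurable k (by omega)) le_rfl
    exact (h1.inner h2).neg.sub ((h1.inner h2).pow_const 2)
  have hsub : ∀ᵐ ω ∂μ, rBar rε (fun t => x t ω) T > 3 * d → (ENNReal.ofReal δ)⁻¹ ≤ Z ω := by
    filter_upwards [hgb] with ω hg hr
    have hS : d ^ 2 < ∑ t ∈ Finset.range T, -inner ℝ (g t ω) (η t ω • (x t ω - xs)) := by
      by_contra! hS
      exact hr.not_ge ((h ω).rBar_le hX hx₀ hxs hg hrε (by linarith) hrd hS)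
    have hV : ∑ t ∈ Finset.range T, inner ℝ (g t ω) (η t ω • (x t ω - xs)) ^ 2 ≤
        (4 * d) ^ 2 * ((3 * d) ^ 2 / (4096 * θ ^ 2) * 4) := by
      calc _ ≤ ∑ t ∈ Finset.range T, (4 * d) ^ 2 * (η t ω ^ 2 * ‖g t ω‖ ^ 2) := by
            refine Finset.sum_le_sum fun t _ => ?_
            rw [← sq_abs, ← mul_pow, ← mul_pow]
            have := hinner t ω (g t ω)
            gcongr
        _ ≤ _ := by
            rw [← Finset.mul_sum]
            gcongr
            exact (h ω).sum_stoppedStep_sq_le hX hx₀ hg hrε hθ0 le_rfl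
    have hexp : Real.log δ⁻¹ ≤ ∑ t ∈ Finset.range T,
        (-inner ℝ (g t ω) (w t ω) - inner ℝ (g t ω) (w t ω) ^ 2) := by
      have e : ∑ t ∈ Finset.range T,
          (-inner ℝ (g t ω) (w t ω) - inner ℝ (g t ω) (w t ω) ^ 2) =
          c * ∑ t ∈ Finset.range T, -inner ℝ (g t ω) (η t ω • (x t ω - xs)) -
          c ^ 2 * ∑ t ∈ Finset.range T, inner ℝ (g t ω) (η t ω • (x t ω - xs)) ^ 2 := by
        rw [Finset.mul_sum, Finset.mul_sum, ← Finset.sum_sub_distrib]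
        refine Finset.sum_congr rfl fun t _ => ?_
        simp only [hw]
        rw [inner_smul_right]
        ring
      -- The exponent is at least 8θ - 9, which exceeds log(1/δ) because θ ≥ 4 + log(1/δ).
      have h1 : c * d ^ 2 = 8 * θ := by rw [hcdef]; field_simp
      have h2 : c ^ 2 * ((4 * d) ^ 2 * ((3 * d) ^ 2 / (4096 * θ ^ 2) * 4)) = 9 := by
        rw [hcdef]
        field_simp
        norm_num
      have h3 := mul_le_mul_of_nonneg_left hS.le hcpos.le
      have h4 := mul_le_mul_of_nonneg_left hV (sq_nonneg c)
      rw [e]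
      linarith
    rw [← ENNReal.ofReal_inv_of_pos hδ₀]
    refine ENNReal.ofReal_le_ofReal ?_
    rwa [← Real.log_le_iff_le_exp (inv_pos.2 hδ₀)]
  -- Markov's inequality for Z at level 1/δ.
  calc μ {ω | rBar rε (fun t => x t ω) T > 3 * d} ≤ μ {ω | (ENNReal.ofReal δ)⁻¹ ≤ Z ω} :=
        measure_mono_ae hsub
    _ = ENNReal.ofReal δ * ((ENNReal.ofReal δ)⁻¹ * μ {ω | (ENNReal.ofReal δ)⁻¹ ≤ Z ω}) := by
        rw [← mul_assoc, ENNReal.mul_inv_cancel (by simpa using hδ₀) ENNReal.ofReal_ne_top,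
          one_mul]
    _ ≤ ENNReal.ofReal δ * 1 := by
        gcongr
        exact (mul_meas_ge_le_lintegral hZm _).trans hE
    _ = ENNReal.ofReal δ := mul_one _

theorem mainTheorem2 {m : ℕ} (X : Set (Euc m)) (f : Euc m → ℝ)
    (hX : IsClosed X) (hf : ConvexOn ℝ X f)
    (xs : Euc m) (hxs : xs ∈ X) (hmin : IsMinOn f X xs)
    (x₀ : Euc m) (hx₀ : x₀ ∈ X)
    (rε : ℝ) (hrε : 0 < rε) (hrd : rε ≤ 3 * ‖x₀ - xs‖)
    (δ : ℝ) (hδ₀ : 0 < δ) (hδ₁ : δ < 1) (T : ℕ) :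
    -- stochastic case
    (∀ (O : Kernel (Euc m) (Euc m)) (ℓ : Euc m → ℝ),
      IsStochasticGradientOracle X f O → IsPointwiseBound X O ℓ →
      ∀ (Ω : Type*) [MeasurableSpace Ω] (μ : Measure Ω) [IsProbabilityMeasure μ]
        (x g : ℕ → Ω → Euc m),
        (∀ ω, IsTDoG X ℓ rε (timeUniformLog T δ) x₀ T (fun t => x t ω) (fun t => g t ω)) →
        IsOracleResponse μ O T x g →
        μ {ω | rBar rε (fun t => x t ω) T > 3 * ‖x₀ - xs‖} ≤ ENNReal.ofReal δ) ∧
    -- noiseless case, both with the original factor and with this factor replaced by 1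
    (∀ (ℓ : Euc m → ℝ) (θ : ℝ), θ = timeUniformLog T δ ∨ θ = 1 →
      ContinuousOn ℓ X →
      ∀ x g : ℕ → Euc m,
        IsTDoG X ℓ rε θ x₀ T x g →
        (∀ t < T, g t ∈ subdifferential X f (x t) ∧ ‖g t‖ ≤ ℓ (x t)) →
        rBar rε x T ≤ 3 * ‖x₀ - xs‖) := by
  have hzero : ∀ y : ℕ → Euc m, rBar rε y 0 ≤ 3 * ‖x₀ - xs‖ := fun y =>
    rBar_le_iff.2 ⟨fun k hk => by
      rw [Nat.le_zero.1 hk, sub_self, norm_zero]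
      positivity, hrd⟩
  -- For T = 0 the convention log 0 = 0 makes `timeUniformLog` equal to 0, so the lower bound on θ
  -- fails; but then no step is taken.
  rcases Nat.eq_zero_or_pos T with rfl | hT
  · refine ⟨fun O ℓ _ _ Ω _ μ _ x g _ _ => ?_, fun ℓ θ _ _ x g _ _ => hzero x⟩
    have : {ω | rBar rε (fun t => x t ω) 0 > 3 * ‖x₀ - xs‖} = ∅ :=
      Set.eq_empty_of_forall_notMem fun ω hω => hω.not_ge (hzero _)
    simp [this]
  · have hθ := four_add_log_inv_le_timeUniformLog hT hδ₀
    refine ⟨fun O ℓ hO hℓ Ω _ μ _ x g h hresp =>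
      measure_rBar_gt_le hX hf.1 hxs hmin hx₀ hrε hrd hδ₀ hδ₁ hθ hO hℓ h hresp,
      fun ℓ θ hθ' _ x g h hg => ?_⟩
    have hθ1 : 1 ≤ θ := by
      rcases hθ' with rfl | rfl
      · have := Real.log_pos ((one_lt_inv₀ hδ₀).2 hδ₁)
        linarith
      · exact le_rfl
    refine h.rBar_le hf.1 hx₀ hxs (fun t ht => (hg t ht).2) hrε hθ1 hrd ?_
    -- With exact subgradients every first-order term is nonpositive.
    refine (Finset.sum_nonpos fun t ht => ?_).trans (sq_nonneg _)
    rw [Finset.mem_range] at ht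
    rw [inner_smul_right, neg_nonpos]
    exact mul_nonneg (stoppedStep_nonneg hrε)
      (inner_sub_nonneg_of_mem_subdifferential hxs hmin (h.mem hx₀ t ht.le) (hg t ht).1)
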